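/- Let $L,H>0$ and let $\varphi\in C^2([0,H])$, $\varphi\not\equiv 0$, solve the nonlocal boundary value problem $$\varphi'-(\varphi')^2+\varphi\varphi''+\frac{2}{H}\int_0^H(\varphi'(y))^2\,dy=0\ \text{ on }[0,H],\qquad \varphi(0)=\varphi(H)=0 .$$ Let $k$ be a positive integer. Let $J\subseteq[0,\infty)$ be an interval containing $0$ and more than one point, and let $(u,w)$ be a smooth solution on $J$ of the two-dimensional inviscid hydrostatic system $$u_t+uu_x+wu_z+p_x=0,\qquad p_z=0,\qquad u_x+w_z=0\qquad (x\in\mathbb R,\ 0\le z\le H,\ t\in J),$$ where $u,p,w$ are functions of $(x,z,t)$, subject to $w|_{z=0}=w|_{z=H}=0$, to periodicity with period $L$ in $x$ of $u$, $p$ and $w$, and to the symmetry $u(-x,z,t)=-u(x,z,t)$, $p(-x,z,t)=p(x,z,t)$, $w(-x,z,t)=w(x,z,t)$, with initial values $$u(x,z,0)=\frac{-L}{2\pi k}\sin\Big(\frac{2\pi k}{L}x\Big)\varphi'(z),\qquad w(x,z,0)=\cos\Big(\frac{2\pi k}{L}x\Big)\varphi(z).$$ It is enough that the solution is smooth in the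 sense that $u,w$ are continuously differentiable on $\mathbb R\times[0,H]\times J$, up to the boundary, and that for each $t\in J$ the pressure $p(\cdot,\cdot,t)$ is continuously differentiable on $\mathbb R\times[0,H]$. Then the solution blows up in finite time, no later than $t=1$: $J\subseteq[0,1)$, so that no such solution, and no smooth continuation of one, reaches the time $t=1$. Moreover $w(0,z,t)=\varphi(z)/(1-t)$ for all $t\in J$ and $z\in[0,H]$; in particular, if $J=[0,1)$, then $|w(0,z,t)|\to\infty$ as $t\to1^-$ for every $z\in[0,H]$ with $\varphi(z)\ne0$. -/

import Mathlib

open Set Filter Topology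

/-- `φ` is a nontrivial solution on `[0, H]` of the nonlocal boundary value problem
`φ' - (φ')² + φ φ'' + (2/H) ∫₀ᴴ (φ')² = 0`, `φ(0) = φ(H) = 0`.
Derivatives at the end points are one-sided. -/
structure IsNontrivialProfile (H : ℝ) (φ : ℝ → ℝ) : Prop where
  contDiffOn : ContDiffOn ℝ 2 φ (Icc 0 H)
  equation : ∀ z ∈ Icc 0 H,
    derivWithin φ (Icc 0 H) z - (derivWithin φ (Icc 0 H) z) ^ 2
      + φ z * derivWithin (derivWithin φ (Icc 0 H)) (Icc 0 H) z
      + 2 / H * ∫ y in (0 : ℝ)..H, (derivWithin φ (Icc 0 H) y) ^ 2 = 0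
  left_eq_zero : φ 0 = 0
  right_eq_zero : φ H = 0
  nontrivial : ∃ z ∈ Icc 0 H, φ z ≠ 0

/-- `(u, w)`, with pressure `p`, is a classical solution on the time interval `J` of the
two-dimensional inviscid hydrostatic system in the channel `ℝ × [0, H]`, with no normal flow at the
bottom and the top, horizontal period `L`, and the odd / even / even symmetry of `u`, `p`, `w`
in `x`. The arguments of `u`, `w`, `p` are `x`, `z`, `t` in this order; `u` and `w` are `C¹` in
`(x, z, t)` up to the boundary, `p` is `C¹` in `(x, z)` at each time. Derivatives in `z` and `t` are
taken within `[0, H]` and `J`, that is, they are one-sided at end points. -/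
structure IsHydrostaticSolution (L H : ℝ) (J : Set ℝ) (u w p : ℝ → ℝ → ℝ → ℝ) : Prop where
  contDiffOn_u : ContDiffOn ℝ 1 (fun q : ℝ × ℝ × ℝ => u q.1 q.2.1 q.2.2)
    (univ ×ˢ Icc 0 H ×ˢ J)
  contDiffOn_w : ContDiffOn ℝ 1 (fun q : ℝ × ℝ × ℝ => w q.1 q.2.1 q.2.2)
    (univ ×ˢ Icc 0 H ×ˢ J)
  contDiffOn_p : ∀ t ∈ J, ContDiffOn ℝ 1 (fun q : ℝ × ℝ => p q.1 q.2 t) (univ ×ˢ Icc 0 H)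
  /-- `u_t + u u_x + w u_z + p_x = 0` -/
  momentum : ∀ x : ℝ, ∀ z ∈ Icc 0 H, ∀ t ∈ J,
    derivWithin (fun s => u x z s) J t
      + u x z t * deriv (fun y => u y z t) x
      + w x z t * derivWithin (fun y => u x y t) (Icc 0 H) z
      + deriv (fun y => p y z t) x = 0
  /-- `p_z = 0` -/
  hydrostatic : ∀ x : ℝ, ∀ z ∈ Icc 0 H, ∀ t ∈ J,
    derivWithin (fun y => p x y t) (Icc 0 H) z = 0
  /-- `u_x + w_z = 0` -/
  incompressible : ∀ x : ℝ, ∀ z ∈ Icc 0 H, ∀ t ∈ J,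
    deriv (fun y => u y z t) x + derivWithin (fun y => w x y t) (Icc 0 H) z = 0
  w_bottom : ∀ x : ℝ, ∀ t ∈ J, w x 0 t = 0
  w_top : ∀ x : ℝ, ∀ t ∈ J, w x H t = 0
  periodic_u : ∀ x : ℝ, ∀ z ∈ Icc 0 H, ∀ t ∈ J, u (x + L) z t = u x z t
  periodic_p : ∀ x : ℝ, ∀ z ∈ Icc 0 H, ∀ t ∈ J, p (x + L) z t = p x z t
  periodic_w : ∀ x : ℝ, ∀ z ∈ Icc 0 H, ∀ t ∈ J, w (x + L) z t = w x z t
  odd_u : ∀ x : ℝ, ∀ z ∈ Icc 0 H, ∀ t ∈ J, u (-x) z t = -u x z t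
  even_p : ∀ x : ℝ, ∀ z ∈ Icc 0 H, ∀ t ∈ J, p (-x) z t = p x z t
  even_w : ∀ x : ℝ, ∀ z ∈ Icc 0 H, ∀ t ∈ J, w (-x) z t = w x z t

/-! On the symmetry axis `x = 0` the horizontal velocity vanishes. Formally differentiating the
momentum equation in `x` there gives, for `a = u_x(0,z,t)`, the closed nonlocal equation `a_t + a² +
w a_z = -p_xx`, with `w_z = -a` and a right side independent of `z`. The profile equation says
exactly that `a = -φ'/(1-t)`, `w = φ/(1-t)` solves it, and the initial data agree, so uniqueness
forces the blow-up at `t = 1`.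

The solution is only `C¹`, so the momentum equation cannot be differentiated in `x`. The quotient
`u(x,z,t)/x` at a small fixed `x > 0` replaces `u_x(0,z,t)`. Its deviation `d = u/x + φ'/(1-t)` from
the self-similar solution obeys a transport equation whose source is controlled by `|d|`, `∫|d|` and
an error `ε` coming from the uniform continuity of `u_x` on a compact set. The pressure term does
not depend on `z` and `d` has mean zero in `z`, so it drops out of the `L²` estimate
(`transport_energy_estimate`, with `abs_source_le` for the source). Gronwall gives `‖d‖ = O(ε)` up
to any `T < 1` in `J`, and `ε → 0` yields `IsHydrostaticSolution.w_zero_eq`. Continuity of `w` then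
excludes `1 ∈ J`. -/

/-! ### Parameter integrals and Cauchy–Schwarz. -/

theorem continuousOn_intervalIntegral_of_continuousOn_prod {H a b : ℝ} (hH : 0 ≤ H)
    {F : ℝ → ℝ → ℝ} (hF : ContinuousOn (fun q : ℝ × ℝ => F q.1 q.2) (Icc 0 H ×ˢ Icc a b)) :
    ContinuousOn (fun t => ∫ z in (0 : ℝ)..H, F z t) (Icc a b) := by
  obtain ⟨C, hC⟩ := (isCompact_Icc.prod isCompact_Icc).exists_bound_of_continuousOn hF
  have hsec : ∀ t ∈ Icc a b, ContinuousOn (fun z => F z t) (Icc 0 H) := fun t ht =>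
    hF.comp (f := fun z => (z, t)) (by fun_prop) fun z hz => ⟨hz, ht⟩
  intro t₀ ht₀
  refine intervalIntegral.continuousWithinAt_of_dominated_interval (bound := fun _ => C) ?_ ?_
    intervalIntegrable_const ?_
  · filter_upwards [self_mem_nhdsWithin] with t ht
    rw [uIoc_of_le hH]
    exact ((hsec t ht).mono Ioc_subset_Icc_self).aestronglyMeasurable measurableSet_Ioc
  · filter_upwards [self_mem_nhdsWithin] with t ht
    refine Eventually.of_forall fun z hz => ?_
    rw [uIoc_of_le hH] at hz
    exact hC (z, t) ⟨Ioc_subset_Icc_self hz, ht⟩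
  · refine Eventually.of_forall fun z hz => ?_
    rw [uIoc_of_le hH] at hz
    exact (hF.comp (f := fun t => (z, t)) (by fun_prop)
      fun t ht => ⟨Ioc_subset_Icc_self hz, ht⟩) t₀ ht₀

theorem hasDerivAt_intervalIntegral_of_continuousOn_prod {H a b : ℝ} (hH : 0 ≤ H)
    {F F' : ℝ → ℝ → ℝ} (hF : ContinuousOn (fun q : ℝ × ℝ => F q.1 q.2) (Icc 0 H ×ˢ Icc a b))
    (hF' : ContinuousOn (fun q : ℝ × ℝ => F' q.1 q.2) (Icc 0 H ×ˢ Icc a b))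
    (hd : ∀ z ∈ Icc 0 H, ∀ t ∈ Ioo a b, HasDerivAt (F z) (F' z t) t) {t₀ : ℝ}
    (ht₀ : t₀ ∈ Ioo a b) :
    HasDerivAt (fun t => ∫ z in (0 : ℝ)..H, F z t) (∫ z in (0 : ℝ)..H, F' z t₀) t₀ := by
  obtain ⟨C, hC⟩ := (isCompact_Icc.prod isCompact_Icc).exists_bound_of_continuousOn hF'
  have hsec : ∀ G : ℝ → ℝ → ℝ, ContinuousOn (fun q : ℝ × ℝ => G q.1 q.2) (Icc 0 H ×ˢ Icc a b) →
      ∀ t ∈ Icc a b, ContinuousOn (fun z => G z t) (Icc 0 H) := fun G hG t ht =>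
    hG.comp (f := fun z => (z, t)) (by fun_prop) fun z hz => ⟨hz, ht⟩
  have hmeas : ∀ G : ℝ → ℝ → ℝ, ContinuousOn (fun q : ℝ × ℝ => G q.1 q.2) (Icc 0 H ×ˢ Icc a b) →
      ∀ t ∈ Icc a b, MeasureTheory.AEStronglyMeasurable (fun z => G z t)
        (MeasureTheory.volume.restrict (uIoc 0 H)) := fun G hG t ht => by
    rw [uIoc_of_le hH]
    exact ((hsec G hG t ht).mono Ioc_subset_Icc_self).aestronglyMeasurable measurableSet_Ioc
  have hnhds : Ioo a b ∈ 𝓝 t₀ := Ioo_mem_nhds ht₀.1 ht₀.2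
  refine (intervalIntegral.hasDerivAt_integral_of_dominated_loc_of_deriv_le
    (F := fun t z => F z t) (F' := fun t z => F' z t) (bound := fun _ => C) hnhds ?_ ?_
    (hmeas F' hF' t₀ (Ioo_subset_Icc_self ht₀)) ?_ intervalIntegrable_const ?_).2
  · filter_upwards [hnhds] with t ht using hmeas F hF t (Ioo_subset_Icc_self ht)
  · exact (hsec F hF t₀ (Ioo_subset_Icc_self ht₀)).intervalIntegrable_of_Icc hH
  · refine Eventually.of_forall fun z hz t ht => ?_
    rw [uIoc_of_le hH] at hz
    exact hC (z, t) ⟨Ioc_subset_Icc_self hz, Ioo_subset_Icc_self ht⟩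
  · refine Eventually.of_forall fun z hz t ht => ?_
    rw [uIoc_of_le hH] at hz
    exact hd z (Ioc_subset_Icc_self hz) t ht

/-- Cauchy–Schwarz against the constant `1`, obtained by expanding `∫ (|f| - I/H)² ≥ 0`, where `I/H`
is the mean of `|f|`. -/
theorem sq_integral_abs_le {H : ℝ} (hH : 0 < H) {f : ℝ → ℝ} (hf : ContinuousOn f (Icc 0 H)) :
    (∫ z in (0 : ℝ)..H, |f z|) ^ 2 ≤ H * ∫ z in (0 : ℝ)..H, f z ^ 2 := by
  set I := ∫ z in (0 : ℝ)..H, |f z| with hI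
  have h1 : IntervalIntegrable (fun z => |f z|) MeasureTheory.volume 0 H :=
    hf.abs.intervalIntegrable_of_Icc hH.le
  have h2 : IntervalIntegrable (fun z => f z ^ 2) MeasureTheory.volume 0 H :=
    (hf.pow 2).intervalIntegrable_of_Icc hH.le
  have h0 : 0 ≤ ∫ z in (0 : ℝ)..H, (f z ^ 2 - 2 * (I / H) * |f z| + (I / H) ^ 2) := by
    refine intervalIntegral.integral_nonneg hH.le fun z _ => ?_
    rw [← sq_abs (f z)]
    nlinarith [sq_nonneg (|f z| - I / H)]
  rw [intervalIntegral.integral_add (h2.sub (h1.const_mul _)) intervalIntegrable_const,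
    intervalIntegral.integral_sub h2 (h1.const_mul _), intervalIntegral.integral_const_mul,
    ← hI, intervalIntegral.integral_const, smul_eq_mul, sub_zero] at h0
  have h3 : H * ((∫ z in (0 : ℝ)..H, f z ^ 2) - 2 * (I / H) * I + H * (I / H) ^ 2)
      = H * (∫ z in (0 : ℝ)..H, f z ^ 2) - I ^ 2 := by
    field_simp
    ring
  have := mul_nonneg hH.le h0
  linarith

/-! ### The `L²` estimate for the transport equation. -/

/-- Energy estimate for the linear transport equation `d_t + w d_z + g = q(t)` with mean-zero `d`
and `w` vanishing at both ends. -/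
theorem transport_energy_estimate {H T K ε : ℝ} (hH : 0 < H) (hK : 0 ≤ K)
    {d dt dz w b g : ℝ → ℝ → ℝ} {q : ℝ → ℝ}
    (hd : ContinuousOn (fun r : ℝ × ℝ => d r.1 r.2) (Icc 0 H ×ˢ Icc 0 T))
    (hdt : ContinuousOn (fun r : ℝ × ℝ => dt r.1 r.2) (Icc 0 H ×ˢ Icc 0 T))
    (hdz : ∀ t ∈ Icc 0 T, ContinuousOn (fun z => dz z t) (Icc 0 H))
    (hb : ∀ t ∈ Icc 0 T, ContinuousOn (fun z => b z t) (Icc 0 H))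
    (hd_t : ∀ z ∈ Icc 0 H, ∀ t ∈ Ioo 0 T, HasDerivAt (d z) (dt z t) t)
    (hd_z : ∀ t ∈ Icc 0 T, ∀ z ∈ Icc 0 H,
      HasDerivWithinAt (fun y => d y t) (dz z t) (Icc 0 H) z)
    (hw_z : ∀ t ∈ Icc 0 T, ∀ z ∈ Icc 0 H,
      HasDerivWithinAt (fun y => w y t) (-b z t) (Icc 0 H) z)
    (hw0 : ∀ t ∈ Icc 0 T, w 0 t = 0) (hwH : ∀ t ∈ Icc 0 T, w H t = 0)
    (heq : ∀ t ∈ Icc 0 T, ∀ z ∈ Icc 0 H, dt z t + w z t * dz z t + g z t = q t)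
    (hg : ∀ t ∈ Icc 0 T, ∀ z ∈ Icc 0 H,
      |g z t| ≤ K * (|d z t| + (∫ y in (0 : ℝ)..H, |d y t|) + ε))
    (hbK : ∀ t ∈ Icc 0 T, ∀ z ∈ Icc 0 H, |b z t| ≤ K)
    (hmean : ∀ t ∈ Icc 0 T, ∫ z in (0 : ℝ)..H, d z t = 0) :
    ∀ t ∈ Icc 0 T, (∫ z in (0 : ℝ)..H, d z t ^ 2) ≤
      ((∫ z in (0 : ℝ)..H, d z 0 ^ 2) + ε ^ 2) * Real.exp (K * (4 + 2 * H) * T) := by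
  set C := K * (4 + 2 * H) with hC
  have hC0 : 0 ≤ C := by positivity
  set E : ℝ → ℝ := fun t => ∫ z in (0 : ℝ)..H, d z t ^ 2 with hE
  have hEcont : ContinuousOn E (Icc 0 T) :=
    continuousOn_intervalIntegral_of_continuousOn_prod (F := fun z t => d z t ^ 2) hH.le (hd.pow 2)
  have hEderiv : ∀ t ∈ Ioo 0 T, HasDerivAt E (∫ z in (0 : ℝ)..H, 2 * d z t * dt z t) t := by
    intro t ht
    refine hasDerivAt_intervalIntegral_of_continuousOn_prod (F := fun z t => d z t ^ 2)
      (F' := fun z t => 2 * d z t * dt z t) hH.le (hd.pow 2) ((hd.const_smul (2 : ℝ)).mul hdt)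
      (fun z hz s hs => ?_) ht
    simpa using (hd_t z hz s hs).fun_pow 2
  have hbound : ∀ t ∈ Ioo 0 T,
      (∫ z in (0 : ℝ)..H, 2 * d z t * dt z t) ≤ C * (E t + ε ^ 2) := by
    intro t ht'
    have ht := Ioo_subset_Icc_self ht'
    have hdc : ContinuousOn (fun z => d z t) (Icc 0 H) :=
      hd.comp (f := fun z => (z, t)) (by fun_prop) fun z hz => ⟨hz, ht⟩
    have hdtc : ContinuousOn (fun z => dt z t) (Icc 0 H) :=
      hdt.comp (f := fun z => (z, t)) (by fun_prop) fun z hz => ⟨hz, ht⟩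
    have hwc : ContinuousOn (fun z => w z t) (Icc 0 H) :=
      fun z hz => (hw_z t ht z hz).continuousWithinAt
    have hii : ∀ f : ℝ → ℝ, ContinuousOn f (Icc 0 H) →
      IntervalIntegrable f MeasureTheory.volume 0 H := fun f hf => hf.intervalIntegrable_of_Icc hH.le
    -- The integrand is `(w d²)_z`, and `w` vanishes at both ends.
    have hparts : ∫ z in (0 : ℝ)..H, (-b z t * d z t ^ 2 + w z t * (2 * d z t * dz z t)) = 0 := by
      have := intervalIntegral.integral_deriv_mul_eq_sub_of_hasDerivWithinAt
        (a := 0) (b := H) (u := fun z => w z t) (v := fun z => d z t ^ 2)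
        (u' := fun z => -b z t) (v' := fun z => 2 * d z t * dz z t)
        (by rw [uIcc_of_le hH.le]; exact hw_z t ht)
        (by
          rw [uIcc_of_le hH.le]
          intro z hz
          simpa using (hd_z t ht z hz).fun_pow 2)
        (hii _ (hb t ht).neg) (hii _ ((hdc.const_smul (2 : ℝ)).mul (hdz t ht)))
      rw [this, hw0 t ht, hwH t ht]
      ring
    set I := ∫ y in (0 : ℝ)..H, |d y t| with hI
    have hI0 : 0 ≤ I := intervalIntegral.integral_nonneg hH.le fun z _ => abs_nonneg _
    have hIE : I ^ 2 ≤ H * E t := sq_integral_abs_le hH hdc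
    -- Two vanishing integrals are inserted: the total derivative `(w d²)_z`, which completes the
    -- transport term, and `2 q(t) d`, which is zero by the mean condition and removes `q`.
    have h1 : (∫ z in (0 : ℝ)..H, 2 * d z t * dt z t) =
        ∫ z in (0 : ℝ)..H, (2 * d z t * dt z t
          + (-b z t * d z t ^ 2 + w z t * (2 * d z t * dz z t)) - 2 * q t * d z t) := by
      rw [intervalIntegral.integral_sub, intervalIntegral.integral_add, hparts,
        intervalIntegral.integral_const_mul, hmean t ht]
      · ring
      · exact hii _ ((hdc.const_smul (2 : ℝ)).mul hdtc)
      · exact hii _ (((hb t ht).neg.mul (hdc.pow 2)).add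
          (hwc.mul ((hdc.const_smul (2 : ℝ)).mul (hdz t ht))))
      · exact hii _ (((hdc.const_smul (2 : ℝ)).mul hdtc).add (((hb t ht).neg.mul (hdc.pow 2)).add
          (hwc.mul ((hdc.const_smul (2 : ℝ)).mul (hdz t ht)))))
      · exact hii _ (hdc.const_smul (2 * q t))
    have h2 : (∫ z in (0 : ℝ)..H, 2 * d z t * dt z t) ≤
        ∫ z in (0 : ℝ)..H, (4 * K * d z t ^ 2 + 2 * K * I * |d z t| + K * ε ^ 2) := by
      rw [h1]
      refine intervalIntegral.integral_mono_on hH.le ?_ ?_ fun z hz => ?_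
      · exact hii _ ((((hdc.const_smul (2 : ℝ)).mul hdtc).add (((hb t ht).neg.mul (hdc.pow 2)).add
          (hwc.mul ((hdc.const_smul (2 : ℝ)).mul (hdz t ht))))).sub (hdc.const_smul (2 * q t)))
      · exact hii _ (((hdc.pow 2).const_smul (4 * K)).add
          (hdc.abs.const_smul (2 * K * I)) |>.add continuousOn_const)
      -- The coefficient `4K` of `d²` collects `K` from `b`, `2K` from the source and `K` from
      -- Young's inequality for `2|d|ε`.
      · have e1 : 2 * d z t * dt z t + (-b z t * d z t ^ 2 + w z t * (2 * d z t * dz z t))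
            - 2 * q t * d z t = -b z t * d z t ^ 2 + 2 * (-(d z t * g z t)) := by
          rw [← heq t ht z hz]; ring
        have e2 : -b z t * d z t ^ 2 ≤ K * d z t ^ 2 :=
          mul_le_mul_of_nonneg_right (neg_le.mp (neg_le_of_abs_le (hbK t ht z hz)))
            (sq_nonneg _)
        have e3 : -(d z t * g z t) ≤ |d z t| * (K * (|d z t| + I + ε)) := by
          refine (neg_le_abs _).trans ?_
          rw [abs_mul]
          exact mul_le_mul_of_nonneg_left (hg t ht z hz) (abs_nonneg _)
        have e4 : K * (2 * |d z t| * ε) ≤ K * (d z t ^ 2 + ε ^ 2) := by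
          refine mul_le_mul_of_nonneg_left ?_ hK
          rw [← sq_abs (d z t)]
          nlinarith [sq_nonneg (|d z t| - ε)]
        rw [e1]
        rw [← sq_abs (d z t)] at e2 e4 ⊢
        nlinarith
    have h3 : ∫ z in (0 : ℝ)..H, (4 * K * d z t ^ 2 + 2 * K * I * |d z t| + K * ε ^ 2)
        = 4 * K * E t + 2 * K * I * I + H * (K * ε ^ 2) := by
      rw [intervalIntegral.integral_add, intervalIntegral.integral_add,
        intervalIntegral.integral_const_mul, intervalIntegral.integral_const_mul,
        intervalIntegral.integral_const, smul_eq_mul, sub_zero]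
      · exact hii _ ((hdc.pow 2).const_smul (4 * K))
      · exact hii _ (hdc.abs.const_smul (2 * K * I))
      · exact hii _ (((hdc.pow 2).const_smul (4 * K)).add (hdc.abs.const_smul (2 * K * I)))
      · exact intervalIntegrable_const
    have h4 : K * I ^ 2 ≤ K * (H * E t) := mul_le_mul_of_nonneg_left hIE hK
    have h5 : 0 ≤ K * ε ^ 2 := by positivity
    have h6 : 0 ≤ H * (K * ε ^ 2) := by positivity
    rw [h3] at h2
    rw [hC]
    nlinarith
  -- Gronwall for `E + ε²`, by means of an integrating factor.
  have hanti : AntitoneOn (fun t => (E t + ε ^ 2) * Real.exp (-C * t)) (Icc 0 T) := by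
    have hder : ∀ t ∈ Ioo 0 T, HasDerivAt (fun t => (E t + ε ^ 2) * Real.exp (-C * t))
        ((∫ z in (0 : ℝ)..H, 2 * d z t * dt z t) * Real.exp (-C * t)
          + (E t + ε ^ 2) * (Real.exp (-C * t) * (-C))) t := fun t ht => by
      have h : HasDerivAt (fun t => -C * t) (-C) t := by
        simpa using (hasDerivAt_id t).const_mul (-C)
      exact ((hEderiv t ht).add_const _).mul h.exp
    refine antitoneOn_of_deriv_nonpos (convex_Icc 0 T) ?_ ?_ ?_
    · exact (hEcont.add continuousOn_const).mul (by fun_prop)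
    · rw [interior_Icc]
      exact fun t ht => (hder t ht).differentiableAt.differentiableWithinAt
    · rw [interior_Icc]
      intro t ht
      rw [(hder t ht).deriv]
      have := mul_le_mul_of_nonneg_right (hbound t ht) (Real.exp_pos (-C * t)).le
      linarith
  intro t ht
  have h := hanti ⟨le_rfl, ht.1.trans ht.2⟩ ht ht.1
  simp only [mul_zero, Real.exp_zero, mul_one] at h
  have hE0 : 0 ≤ E 0 + ε ^ 2 :=
    add_nonneg (intervalIntegral.integral_nonneg hH.le fun z _ => sq_nonneg _) (sq_nonneg _)
  calc E t ≤ E t + ε ^ 2 := le_add_of_nonneg_right (sq_nonneg _)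
    _ = (E t + ε ^ 2) * Real.exp (-C * t) * Real.exp (C * t) := by
      rw [mul_assoc, ← Real.exp_add]; simp
    _ ≤ (E 0 + ε ^ 2) * Real.exp (C * t) := mul_le_mul_of_nonneg_right h (Real.exp_pos _).le
    _ ≤ (E 0 + ε ^ 2) * Real.exp (C * T) := by
      refine mul_le_mul_of_nonneg_left (Real.exp_le_exp.mpr ?_) hE0
      exact mul_le_mul_of_nonneg_left ht.2 hC0

/-! ### Partial derivatives and first consequences of the system. -/

theorem exists_continuousOn_partials {Z J : Set ℝ} (hZ : UniqueDiffOn ℝ Z)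
    (hJ : UniqueDiffOn ℝ J) {f : ℝ → ℝ → ℝ → ℝ}
    (hf : ContDiffOn ℝ 1 (fun q : ℝ × ℝ × ℝ => f q.1 q.2.1 q.2.2) (univ ×ˢ Z ×ˢ J)) :
    ∃ fx fz ft : ℝ → ℝ → ℝ → ℝ,
      ContinuousOn (fun q : ℝ × ℝ × ℝ => fx q.1 q.2.1 q.2.2) (univ ×ˢ Z ×ˢ J) ∧
      ContinuousOn (fun q : ℝ × ℝ × ℝ => fz q.1 q.2.1 q.2.2) (univ ×ˢ Z ×ˢ J) ∧
      ContinuousOn (fun q : ℝ × ℝ × ℝ => ft q.1 q.2.1 q.2.2) (univ ×ˢ Z ×ˢ J) ∧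
      ∀ x : ℝ, ∀ z ∈ Z, ∀ t ∈ J,
        HasDerivAt (fun y => f y z t) (fx x z t) x ∧
        HasDerivWithinAt (fun y => f x y t) (fz x z t) Z z ∧
        HasDerivWithinAt (fun s => f x z s) (ft x z t) J t := by
  set S : Set (ℝ × ℝ × ℝ) := univ ×ˢ Z ×ˢ J
  set F : ℝ × ℝ × ℝ → ℝ := fun q => f q.1 q.2.1 q.2.2
  have hG : ContinuousOn (fderivWithin ℝ F S) S :=
    hf.continuousOn_fderivWithin (uniqueDiffOn_univ.prod (hZ.prod hJ)) le_rfl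
  refine ⟨fun x z t => fderivWithin ℝ F S (x, z, t) (1, 0, 0),
    fun x z t => fderivWithin ℝ F S (x, z, t) (0, 1, 0),
    fun x z t => fderivWithin ℝ F S (x, z, t) (0, 0, 1),
    hG.clm_apply continuousOn_const, hG.clm_apply continuousOn_const,
    hG.clm_apply continuousOn_const, fun x z hz t ht => ?_⟩
  have hF : HasFDerivWithinAt F (fderivWithin ℝ F S (x, z, t)) S (x, z, t) :=
    (hf.differentiableOn one_ne_zero (x, z, t) ⟨mem_univ _, hz, ht⟩).hasFDerivWithinAt
  refine ⟨?_, ?_, ?_⟩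
  · rw [← hasDerivWithinAt_univ]
    exact hF.comp_hasDerivWithinAt (f := fun y : ℝ => (y, z, t)) x
      ((hasDerivWithinAt_id x univ).prodMk (hasDerivWithinAt_const x univ (z, t)))
      fun y _ => ⟨mem_univ _, hz, ht⟩
  · exact hF.comp_hasDerivWithinAt (f := fun y : ℝ => (x, y, t)) z
      ((hasDerivWithinAt_const z Z x).prodMk
        ((hasDerivWithinAt_id z Z).prodMk (hasDerivWithinAt_const z Z t)))
      fun y hy => ⟨mem_univ _, hy, ht⟩
  · exact hF.comp_hasDerivWithinAt (f := fun y : ℝ => (x, z, y)) t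
      ((hasDerivWithinAt_const t J x).prodMk
        ((hasDerivWithinAt_const t J z).prodMk (hasDerivWithinAt_id t J)))
      fun y hy => ⟨mem_univ _, hz, hy⟩

/-- The partial derivatives of `u` are continuous, those of `w` and `p` are eliminated in favour of
`u_x` and a horizontal pressure gradient that does not depend on `z`. -/
theorem IsHydrostaticSolution.exists_partials {L H : ℝ} {J : Set ℝ} {u w p : ℝ → ℝ → ℝ → ℝ}
    (hsol : IsHydrostaticSolution L H J u w p) (hH : 0 < H) (hJ : UniqueDiffOn ℝ J) :
    ∃ (ux uz ut : ℝ → ℝ → ℝ → ℝ) (px : ℝ → ℝ → ℝ),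
      ContinuousOn (fun q : ℝ × ℝ × ℝ => ux q.1 q.2.1 q.2.2) (univ ×ˢ Icc 0 H ×ˢ J) ∧
      ContinuousOn (fun q : ℝ × ℝ × ℝ => uz q.1 q.2.1 q.2.2) (univ ×ˢ Icc 0 H ×ˢ J) ∧
      ContinuousOn (fun q : ℝ × ℝ × ℝ => ut q.1 q.2.1 q.2.2) (univ ×ˢ Icc 0 H ×ˢ J) ∧
      ∀ x : ℝ, ∀ z ∈ Icc 0 H, ∀ t ∈ J,
        HasDerivAt (fun y => u y z t) (ux x z t) x ∧
        HasDerivWithinAt (fun y => u x y t) (uz x z t) (Icc 0 H) z ∧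
        HasDerivWithinAt (fun s => u x z s) (ut x z t) J t ∧
        HasDerivWithinAt (fun y => w x y t) (-ux x z t) (Icc 0 H) z ∧
        ut x z t + u x z t * ux x z t + w x z t * uz x z t + px x t = 0 := by
  have hI := uniqueDiffOn_Icc hH
  obtain ⟨ux, uz, ut, hux, huz, hut, hu⟩ := exists_continuousOn_partials hI hJ hsol.contDiffOn_u
  obtain ⟨_, wz, _, -, -, -, hw⟩ := exists_continuousOn_partials hI hJ hsol.contDiffOn_w
  refine ⟨ux, uz, ut, fun x t => deriv (fun y => p y 0 t) x, hux, huz, hut,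
    fun x z hz t ht => ?_⟩
  obtain ⟨h1, h2, h3⟩ := hu x z hz t ht
  have h4 := (hw x z hz t ht).2.1
  have hinc := hsol.incompressible x z hz t ht
  have hmom := hsol.momentum x z hz t ht
  rw [h1.deriv, h4.derivWithin (hI z hz)] at hinc
  rw [h1.deriv, h2.derivWithin (hI z hz), h3.derivWithin (hJ t ht)] at hmom
  -- Since `p_z = 0`, the pressure may be evaluated at the bottom, so `p_x` depends on `x` and `t`
  -- only.
  have hp : (fun y => p y z t) = fun y => p y 0 t := by
    funext y
    refine constant_of_derivWithin_zero (f := fun s => p y s t) ?_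
      (fun s hs => hsol.hydrostatic y s (Ico_subset_Icc_self hs) t ht) z hz
    exact ((hsol.contDiffOn_p t ht).differentiableOn one_ne_zero).comp
      (f := fun s : ℝ => (y, s)) (by fun_prop) fun s hs => ⟨mem_univ _, hs⟩
  rw [hp] at hmom
  refine ⟨h1, h2, h3, ?_, hmom⟩
  rwa [eq_neg_of_add_eq_zero_right hinc] at h4

/-- Recovers `w` from `w_z = -u_x`: an integral bound on the error in `u_x` becomes a pointwise
bound on the error in `w`. -/
theorem abs_le_integral_abs_deriv {H : ℝ} (hH : 0 ≤ H) {f f' : ℝ → ℝ} (h0 : f 0 = 0)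
    (hf : ∀ z ∈ Icc 0 H, HasDerivWithinAt f (f' z) (Icc 0 H) z)
    (hf' : ContinuousOn f' (Icc 0 H)) {z : ℝ} (hz : z ∈ Icc 0 H) :
    |f z| ≤ ∫ y in (0 : ℝ)..H, |f' y| := by
  have hsub : Icc 0 z ⊆ Icc 0 H := Icc_subset_Icc_right hz.2
  have hint : ∫ y in (0 : ℝ)..z, f' y = f z - f 0 :=
    intervalIntegral.integral_eq_sub_of_hasDerivAt_of_le hz.1
      (fun y hy => ((hf y (hsub hy)).continuousWithinAt).mono hsub)
      (fun y hy => (hf y (hsub (Ioo_subset_Icc_self hy))).hasDerivAt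
        (Icc_mem_nhds hy.1 (hy.2.trans_le hz.2)))
      ((hf'.mono hsub).intervalIntegrable_of_Icc hz.1)
  rw [h0, sub_zero] at hint
  rw [← hint]
  refine (intervalIntegral.abs_integral_le_integral_abs hz.1).trans ?_
  exact intervalIntegral.integral_mono_interval le_rfl hz.1 hz.2
    (Eventually.of_forall fun y => abs_nonneg _) (hf'.abs.intervalIntegrable_of_Icc hH)

theorem IsNontrivialProfile.hasDerivWithinAt {H : ℝ} {φ : ℝ → ℝ} (hφ : IsNontrivialProfile H φ)
    {z : ℝ} (hz : z ∈ Icc 0 H) :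
    HasDerivWithinAt φ (derivWithin φ (Icc 0 H) z) (Icc 0 H) z :=
  (hφ.contDiffOn.differentiableOn two_ne_zero z hz).hasDerivWithinAt

theorem IsNontrivialProfile.contDiffOn_derivWithin {H : ℝ} {φ : ℝ → ℝ}
    (hφ : IsNontrivialProfile H φ) (hH : 0 < H) :
    ContDiffOn ℝ 1 (derivWithin φ (Icc 0 H)) (Icc 0 H) :=
  hφ.contDiffOn.derivWithin (uniqueDiffOn_Icc hH) (by norm_num)

theorem IsHydrostaticSolution.u_zero {L H : ℝ} {J : Set ℝ} {u w p : ℝ → ℝ → ℝ → ℝ}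
    (hsol : IsHydrostaticSolution L H J u w p) {z t : ℝ} (hz : z ∈ Icc 0 H) (ht : t ∈ J) :
    u 0 z t = 0 := by
  have := hsol.odd_u 0 z hz t ht
  rw [neg_zero] at this
  linarith

/-- The vertical mean of the horizontal velocity vanishes. -/
theorem IsHydrostaticSolution.integral_u_eq_zero {L H : ℝ} {J : Set ℝ} {u w p ux : ℝ → ℝ → ℝ → ℝ}
    (hsol : IsHydrostaticSolution L H J u w p) (hH : 0 < H)
    (hux : ContinuousOn (fun q : ℝ × ℝ × ℝ => ux q.1 q.2.1 q.2.2) (univ ×ˢ Icc 0 H ×ˢ J))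
    (hu_x : ∀ x : ℝ, ∀ z ∈ Icc 0 H, ∀ t ∈ J, HasDerivAt (fun y => u y z t) (ux x z t) x)
    (hw_z : ∀ x : ℝ, ∀ z ∈ Icc 0 H, ∀ t ∈ J,
      HasDerivWithinAt (fun y => w x y t) (-ux x z t) (Icc 0 H) z)
    (x : ℝ) {t : ℝ} (ht : t ∈ J) :
    ∫ z in (0 : ℝ)..H, u x z t = 0 := by
  have hsec : ∀ (f : ℝ → ℝ → ℝ → ℝ) (a b : ℝ),
      ContinuousOn (fun q : ℝ × ℝ × ℝ => f q.1 q.2.1 q.2.2) (univ ×ˢ Icc 0 H ×ˢ J) →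
      ContinuousOn (fun r : ℝ × ℝ => f r.2 r.1 t) (Icc 0 H ×ˢ Icc a b) := fun f a b hf =>
    hf.comp (f := fun r : ℝ × ℝ => (r.2, r.1, t)) (by fun_prop) fun r hr => ⟨mem_univ _, hr.1, ht⟩
  -- `w` vanishes at bottom and top, so `u_x = -w_z` has mean zero. Hence the mean of `u` is
  -- constant in `x`, and it is zero at `x = 0` by oddness.
  have hzero : ∀ y, ∫ z in (0 : ℝ)..H, ux y z t = 0 := by
    intro y
    have hc : ContinuousOn (fun z => ux y z t) (Icc 0 H) :=
      hux.comp (f := fun z => (y, z, t)) (by fun_prop) fun z hz => ⟨mem_univ _, hz, ht⟩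
    have h := intervalIntegral.integral_eq_sub_of_hasDerivAt_of_le (f := fun z => w y z t)
      (f' := fun z => -ux y z t) hH.le
      (fun z hz => (hw_z y z hz t ht).continuousWithinAt)
      (fun z hz => (hw_z y z (Ioo_subset_Icc_self hz) t ht).hasDerivAt (Icc_mem_nhds hz.1 hz.2))
      (hc.neg.intervalIntegrable_of_Icc hH.le)
    rw [hsol.w_top y t ht, hsol.w_bottom y t ht, intervalIntegral.integral_neg] at h
    linarith
  have hder : ∀ y, HasDerivAt (fun y => ∫ z in (0 : ℝ)..H, u y z t) 0 y := by
    intro y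
    have := hasDerivAt_intervalIntegral_of_continuousOn_prod (F := fun z y => u y z t)
      (F' := fun z y => ux y z t) hH.le
      (hsec u (y - 1) (y + 1) hsol.contDiffOn_u.continuousOn) (hsec ux (y - 1) (y + 1) hux)
      (fun z hz s _ => hu_x s z hz t ht) ⟨sub_one_lt y, lt_add_one y⟩
    rwa [hzero y] at this
  have hconst := is_const_of_deriv_eq_zero (fun y => (hder y).differentiableAt)
    (fun y => (hder y).deriv) x 0
  rw [hconst]
  refine (intervalIntegral.integral_congr (g := fun _ => 0) fun z hz => ?_).trans (by simp)
  rw [uIcc_of_le hH.le] at hz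
  exact hsol.u_zero hz ht

/-! ### Comparison with the self-similar solution. -/

/-- The splitting `ab - v² = a(b - a) + (a - v)(a + v)` exposes the factor `d = a + v`. In the
application `a = u/x`, `b = u_x`, `v = φ'/(1-t)`, `h = w - φ/(1-t)` and `c = φ''/(1-t)`. -/
theorem abs_source_le {a b v d h c I K H ε : ℝ} (hH : 0 ≤ H) (hI : 0 ≤ I) (hd : d = a + v)
    (ha : |a| ≤ K) (hv : |v| ≤ K) (hc : |c| ≤ K) (hε : 0 ≤ ε) (hab : |b - a| ≤ 2 * ε)
    (hh : |h| ≤ I + 2 * H * ε) :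
    |a * b - v ^ 2 - h * c| ≤ K * (2 + 2 * H) * (|d| + I + ε) := by
  have hK : 0 ≤ K := (abs_nonneg _).trans ha
  have e : a * b - v ^ 2 - h * c = a * (b - a) + (a - v) * d - h * c := by rw [hd]; ring
  have h1 : |a * (b - a)| ≤ K * (2 * ε) := by
    rw [abs_mul]; exact mul_le_mul ha hab (abs_nonneg _) hK
  have h2 : |(a - v) * d| ≤ (2 * K) * |d| := by
    rw [abs_mul]
    refine mul_le_mul_of_nonneg_right ?_ (abs_nonneg _)
    linarith [abs_sub a v]
  have h3 : |h * c| ≤ (I + 2 * H * ε) * K := by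
    rw [abs_mul]; exact mul_le_mul hh hc (abs_nonneg _) (by positivity)
  have h4 := abs_sub (a * (b - a) + (a - v) * d) (h * c)
  have h5 := abs_add_le (a * (b - a)) ((a - v) * d)
  have h6 : 0 ≤ K * H * |d| := by positivity
  have h7 : 0 ≤ K * H * I := by positivity
  have h8 : 0 ≤ K * I := by positivity
  rw [e]
  nlinarith

theorem tendsto_abs_div_one_sub_atTop {c : ℝ} (hc : c ≠ 0) :
    Tendsto (fun t : ℝ => |c / (1 - t)|) (𝓝[<] 1) atTop := by
  have h : Tendsto (fun t : ℝ => 1 - t) (𝓝[<] 1) (𝓝[>] 0) := by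
    refine tendsto_nhdsWithin_iff.2 ⟨?_, ?_⟩
    · have : Tendsto (fun t : ℝ => 1 - t) (𝓝 1) (𝓝 (1 - 1)) := by
        apply Continuous.tendsto; fun_prop
      rw [sub_self] at this
      exact this.mono_left nhdsWithin_le_nhds
    · filter_upwards [self_mem_nhdsWithin] with t ht using sub_pos.2 (mem_Iio.1 ht)
  have h2 := (tendsto_inv_nhdsGT_zero.comp h).const_mul_atTop (abs_pos.2 hc)
  refine h2.congr' ?_
  filter_upwards [self_mem_nhdsWithin] with t ht
  rw [abs_div, abs_of_pos (sub_pos.2 (mem_Iio.1 ht)), Function.comp_apply, div_eq_mul_inv]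

theorem IsHydrostaticSolution.w_zero_eq {L H : ℝ} (hL : 0 < L) (hH : 0 < H)
    {φ : ℝ → ℝ} (hφ : IsNontrivialProfile H φ) {k : ℕ} (hk : 0 < k)
    {J : Set ℝ} (hJ : J.OrdConnected) (hJu : UniqueDiffOn ℝ J) (hJ_zero : (0 : ℝ) ∈ J)
    {u w p : ℝ → ℝ → ℝ → ℝ} (hsol : IsHydrostaticSolution L H J u w p)
    (hu_init : ∀ x : ℝ, ∀ z ∈ Icc 0 H,
      u x z 0 = -L / (2 * Real.pi * k) * Real.sin (2 * Real.pi * k / L * x)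
        * derivWithin φ (Icc 0 H) z)
    {T : ℝ} (hT0 : 0 ≤ T) (hT1 : T < 1) (hT : T ∈ J) {z₀ : ℝ} (hz₀ : z₀ ∈ Icc 0 H) :
    w 0 z₀ T = φ z₀ / (1 - T) := by
  obtain ⟨ux, uz, ut, px, hux, huz, hut, hall⟩ := hsol.exists_partials hH hJu
  have hTJ : Icc 0 T ⊆ J := hJ.out hJ_zero hT
  have h1t : ∀ t ∈ Icc 0 T, 0 < 1 - t := fun t ht => by linarith [ht.2]
  set φ₁ := derivWithin φ (Icc 0 H) with hφ₁
  set φ₂ := derivWithin φ₁ (Icc 0 H) with hφ₂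
  have hφ₁C := hφ.contDiffOn_derivWithin hH
  have hφ₁c : ContinuousOn φ₁ (Icc 0 H) := hφ₁C.continuousOn
  have hφ₂c : ContinuousOn φ₂ (Icc 0 H) :=
    hφ₁C.continuousOn_derivWithin (uniqueDiffOn_Icc hH) le_rfl
  have hφ_z : ∀ z ∈ Icc 0 H, HasDerivWithinAt φ (φ₁ z) (Icc 0 H) z :=
    fun z hz => hφ.hasDerivWithinAt hz
  have hφ₁_z : ∀ z ∈ Icc 0 H, HasDerivWithinAt φ₁ (φ₂ z) (Icc 0 H) z :=
    fun z hz => (hφ₁C.differentiableOn one_ne_zero z hz).hasDerivWithinAt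
  have h3 : ∀ f : ℝ → ℝ → ℝ → ℝ,
      ContinuousOn (fun q : ℝ × ℝ × ℝ => f q.1 q.2.1 q.2.2) (univ ×ˢ Icc 0 H ×ˢ J) →
      ∀ x, ContinuousOn (fun r : ℝ × ℝ => f x r.1 r.2) (Icc 0 H ×ˢ Icc 0 T) := fun f hf x =>
    hf.comp (f := fun r : ℝ × ℝ => (x, r.1, r.2)) (by fun_prop)
      fun r hr => ⟨mem_univ _, hr.1, hTJ hr.2⟩
  have h2 : ∀ f : ℝ → ℝ → ℝ → ℝ,
      ContinuousOn (fun q : ℝ × ℝ × ℝ => f q.1 q.2.1 q.2.2) (univ ×ˢ Icc 0 H ×ˢ J) →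
      ∀ x, ∀ t ∈ Icc 0 T, ContinuousOn (fun z => f x z t) (Icc 0 H) := fun f hf x t ht =>
    hf.comp (f := fun z : ℝ => (x, z, t)) (by fun_prop)
      fun z hz => ⟨mem_univ _, hz, hTJ ht⟩
  -- a common bound for the coefficients
  have hφdiv : ∀ f : ℝ → ℝ, ContinuousOn f (Icc 0 H) → ∀ n : ℕ,
      ContinuousOn (fun r : ℝ × ℝ => f r.1 / (1 - r.2) ^ n) (Icc 0 H ×ˢ Icc 0 T) :=
    fun f hf n => (hf.comp continuousOn_fst fun r hr => hr.1).div (by fun_prop)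
      fun r hr => pow_ne_zero _ (h1t r.2 hr.2).ne'
  have hcube : IsCompact (Icc (0 : ℝ) 1 ×ˢ Icc 0 H ×ˢ Icc 0 T) :=
    isCompact_Icc.prod (isCompact_Icc.prod isCompact_Icc)
  have huxcube : ContinuousOn (fun q : ℝ × ℝ × ℝ => ux q.1 q.2.1 q.2.2)
      (Icc (0 : ℝ) 1 ×ˢ Icc 0 H ×ˢ Icc 0 T) :=
    hux.mono (prod_mono (subset_univ _) (prod_mono le_rfl hTJ))
  obtain ⟨M, hM⟩ := hcube.exists_bound_of_continuousOn huxcube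
  obtain ⟨M₁, hM₁⟩ :=
    (isCompact_Icc.prod isCompact_Icc).exists_bound_of_continuousOn (hφdiv φ₁ hφ₁c 1)
  obtain ⟨M₂, hM₂⟩ :=
    (isCompact_Icc.prod isCompact_Icc).exists_bound_of_continuousOn (hφdiv φ₂ hφ₂c 1)
  set K := max M (max M₁ M₂) with hKdef
  have hK : ∀ x ∈ Icc (0 : ℝ) 1, ∀ z ∈ Icc 0 H, ∀ t ∈ Icc 0 T, |ux x z t| ≤ K :=
    fun x hx z hz t ht => (hM (x, z, t) ⟨hx, hz, ht⟩).trans (le_max_left _ _)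
  have hK₁ : ∀ z ∈ Icc 0 H, ∀ t ∈ Icc 0 T, |φ₁ z / (1 - t)| ≤ K := fun z hz t ht => by
    have := hM₁ (z, t) ⟨hz, ht⟩
    simp only [pow_one, Real.norm_eq_abs] at this
    exact this.trans ((le_max_left _ _).trans (le_max_right _ _))
  have hK₂ : ∀ z ∈ Icc 0 H, ∀ t ∈ Icc 0 T, |φ₂ z / (1 - t)| ≤ K := fun z hz t ht => by
    have := hM₂ (z, t) ⟨hz, ht⟩
    simp only [pow_one, Real.norm_eq_abs] at this
    exact this.trans ((le_max_right _ _).trans (le_max_right _ _))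
  have hK0 : 0 ≤ K := (abs_nonneg _).trans
    (hK 0 ⟨le_rfl, zero_le_one⟩ 0 ⟨le_rfl, hH.le⟩ 0 ⟨le_rfl, hT0⟩)
  -- the distance of `w` to the self-similar profile is controlled by that of `u_x`
  have hwdiff : ∀ x, ∀ t ∈ Icc 0 T, ∀ z ∈ Icc 0 H,
      |w x z t - φ z / (1 - t)| ≤ ∫ y in (0 : ℝ)..H, |ux x y t + φ₁ y / (1 - t)| := by
    intro x t ht z hz
    have := abs_le_integral_abs_deriv (f := fun z => w x z t - φ z / (1 - t))
      (f' := fun z => -ux x z t - φ₁ z / (1 - t)) hH.le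
      (by simp [hsol.w_bottom x t (hTJ ht), hφ.left_eq_zero])
      (fun y hy => (hall x y hy t (hTJ ht)).2.2.2.1.sub ((hφ_z y hy).div_const _))
      ((h2 ux hux x t ht).neg.sub (hφ₁c.div_const _)) hz
    refine this.trans_eq (intervalIntegral.integral_congr fun y _ => ?_)
    rw [← abs_neg]
    congr 1
    ring
  have hux0 : ∀ z ∈ Icc 0 H, ux 0 z 0 = -φ₁ z := by
    intro z hz
    have hlin : HasDerivAt (fun y : ℝ => 2 * Real.pi * k / L * y) (2 * Real.pi * k / L) 0 := by
      simpa using (hasDerivAt_id (0 : ℝ)).const_mul (2 * Real.pi * k / L)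
    have h := ((hlin.sin).const_mul (-L / (2 * Real.pi * k))).mul_const (φ₁ z)
    have hfun : (fun y => u y z 0) = fun y =>
        -L / (2 * Real.pi * k) * Real.sin (2 * Real.pi * k / L * y) * φ₁ z :=
      funext fun y => hu_init y z hz
    have hu := (hall 0 z hz 0 hJ_zero).1
    rw [hfun] at hu
    rw [hu.unique h, mul_zero, Real.cos_zero]
    have : (k : ℝ) ≠ 0 := by exact_mod_cast hk.ne'
    field_simp
  -- The root bounds `∫|d|/ε` at time `T`, with `H + 1` from the initial energy `≤ Hε²` plus `ε²`.
  -- The summand `2H` is the cost of passing from `u/x` back to `u_x(0,·)`.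
  set R := Real.sqrt (H * ((H + 1) * Real.exp (K * (2 + 2 * H) * (4 + 2 * H) * T))) + 2 * H with hR
  have hRpos : 0 < R := add_pos_of_nonneg_of_pos (Real.sqrt_nonneg _) (by positivity)
  -- the distance at `x = 0` is arbitrarily small
  have hsmall : ∀ ε > 0, (∫ y in (0 : ℝ)..H, |ux 0 y T + φ₁ y / (1 - T)|) ≤ R * ε := by
    intro ε hε
    obtain ⟨δ, hδ, hunif⟩ := Metric.uniformContinuousOn_iff.1
      (hcube.uniformContinuousOn_of_continuous huxcube) ε hε
    -- `x < δ` makes `u_x` vary by at most `ε` on `[0, x]`; `x < 1` keeps the point in the cube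
    -- where `K` is a bound, so `K` does not depend on `ε`.
    obtain ⟨x, hx0, hx⟩ := exists_between (lt_min hδ one_pos)
    have hxδ : x < δ := hx.trans_le (min_le_left _ _)
    have hx1 : x < 1 := hx.trans_le (min_le_right _ _)
    have hosc : ∀ ξ ∈ Icc 0 x, ∀ z ∈ Icc 0 H, ∀ t ∈ Icc 0 T,
        |ux ξ z t - ux 0 z t| ≤ ε := by
      intro ξ hξ z hz t ht
      have := hunif (ξ, z, t) ⟨⟨hξ.1, hξ.2.trans hx1.le⟩, hz, ht⟩ (0, z, t)
        ⟨⟨le_rfl, zero_le_one⟩, hz, ht⟩ (by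
          simp only [Prod.dist_eq, dist_self, Real.dist_eq, sub_zero, abs_of_nonneg hξ.1]
          simpa using ⟨hξ.2.trans_lt hxδ, hδ⟩)
      rw [Real.dist_eq] at this
      exact this.le
    -- Since `u(0,z,t) = 0`, the mean value theorem writes `u/x` as `u_x(ξ,z,t)` with `0 < ξ < x`.
    have hmvt : ∀ z ∈ Icc 0 H, ∀ t ∈ Icc 0 T,
        |u x z t / x| ≤ K ∧ |u x z t / x - ux 0 z t| ≤ ε := by
      intro z hz t ht
      obtain ⟨ξ, hξ, he⟩ := exists_hasDerivAt_eq_slope (fun y => u y z t) (fun y => ux y z t) hx0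
        (fun y _ => (hall y z hz t (hTJ ht)).1.continuousAt.continuousWithinAt)
        (fun y _ => (hall y z hz t (hTJ ht)).1)
      rw [hsol.u_zero hz (hTJ ht), sub_zero, sub_zero] at he
      rw [← he]
      exact ⟨hK ξ ⟨hξ.1.le, hξ.2.le.trans hx1.le⟩ z hz t ht,
        hosc ξ (Ioo_subset_Icc_self hξ) z hz t ht⟩
    have hx01 : x ∈ Icc (0 : ℝ) 1 := ⟨hx0.le, hx1.le⟩
    set d : ℝ → ℝ → ℝ := fun z t => u x z t / x + φ₁ z / (1 - t) with hd
    have hdc : ContinuousOn (fun r : ℝ × ℝ => d r.1 r.2) (Icc 0 H ×ˢ Icc 0 T) := by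
      have := hφdiv φ₁ hφ₁c 1
      simp only [pow_one] at this
      exact ((h3 u hsol.contDiffOn_u.continuousOn x).div_const x).add this
    have hdsec : ∀ t ∈ Icc 0 T, ContinuousOn (fun z => d z t) (Icc 0 H) := fun t ht =>
      hdc.comp (f := fun z => (z, t)) (by fun_prop) fun z hz => ⟨hz, ht⟩
    have hcompare : ∀ y ∈ Icc 0 x, ∀ t ∈ Icc 0 T,
        (∫ z in (0 : ℝ)..H, |ux y z t + φ₁ z / (1 - t)|) ≤
          (∫ z in (0 : ℝ)..H, |d z t|) + H * (2 * ε) := by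
      intro y hy t ht
      have hint : IntervalIntegrable (fun z => |d z t|) MeasureTheory.volume 0 H :=
        (hdsec t ht).abs.intervalIntegrable_of_Icc hH.le
      have : (∫ z in (0 : ℝ)..H, |d z t|) + H * (2 * ε) =
          ∫ z in (0 : ℝ)..H, (|d z t| + 2 * ε) := by
        rw [intervalIntegral.integral_add hint intervalIntegrable_const,
          intervalIntegral.integral_const, smul_eq_mul, sub_zero]
      rw [this]
      refine intervalIntegral.integral_mono_on hH.le
        (((h2 ux hux y t ht).add (hφ₁c.div_const _)).abs.intervalIntegrable_of_Icc hH.le)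
        (hint.add intervalIntegrable_const) fun z hz => ?_
      have e1 := hosc y hy z hz t ht
      have e2 := (hmvt z hz t ht).2
      rw [abs_sub_comm] at e2
      have e : ux y z t + φ₁ z / (1 - t) =
          d z t + ((ux y z t - ux 0 z t) + (ux 0 z t - u x z t / x)) := by
        simp only [hd]; ring
      rw [e]
      refine (abs_add_le _ _).trans ?_
      linarith [abs_add_le (ux y z t - ux 0 z t) (ux 0 z t - u x z t / x)]
    -- The momentum equation divided by `x` is combined with the profile equation divided by
    -- `(1-t)²`. The pressure gradient and the nonlocal integral are independent of `z` and form
    -- `q`; the transport velocity is the actual `w`, so `w - φ/(1-t)` enters the source.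
    have hE := transport_energy_estimate (T := T) (K := K * (2 + 2 * H)) (ε := ε) hH (by positivity)
      (d := d) (dt := fun z t => ut x z t / x + φ₁ z / (1 - t) ^ 2)
      (dz := fun z t => uz x z t / x + φ₂ z / (1 - t)) (w := fun z t => w x z t)
      (b := fun z t => ux x z t)
      (g := fun z t => u x z t / x * ux x z t - (φ₁ z / (1 - t)) ^ 2
        - (w x z t - φ z / (1 - t)) * (φ₂ z / (1 - t)))
      (q := fun t => -px x t / x - 2 / H * (∫ y in (0 : ℝ)..H, φ₁ y ^ 2) / (1 - t) ^ 2)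
      hdc (((h3 ut hut x).div_const x).add (hφdiv φ₁ hφ₁c 2))
      (fun t ht => ((h2 uz huz x t ht).div_const x).add (hφ₂c.div_const _))
      (fun t ht => h2 ux hux x t ht)
      (by
        intro z hz t ht
        have ht' := Ioo_subset_Icc_self ht
        have hu := ((hall x z hz t (hTJ ht')).2.2.1.mono hTJ).hasDerivAt (Icc_mem_nhds ht.1 ht.2)
        have h1 : HasDerivAt (fun s : ℝ => 1 - s) (-1) t := by
          simpa using (hasDerivAt_id t).const_sub 1
        have h2 := (hu.div_const x).fun_add
          ((hasDerivAt_const t (φ₁ z)).fun_div h1 (h1t t ht').ne')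
        exact h2.congr_deriv (by ring))
      (fun t ht z hz => ((hall x z hz t (hTJ ht)).2.1.div_const x).add
        ((hφ₁_z z hz).div_const _))
      (fun t ht z hz => (hall x z hz t (hTJ ht)).2.2.2.1)
      (fun t ht => hsol.w_bottom x t (hTJ ht)) (fun t ht => hsol.w_top x t (hTJ ht))
      (by
        intro t ht z hz
        have e1 := (hall x z hz t (hTJ ht)).2.2.2.2
        have e2 := hφ.equation z hz
        rw [← hφ₁, ← hφ₂] at e2
        have e3 := (h1t t ht).ne'
        have e4 : ut x z t = -(u x z t * ux x z t + w x z t * uz x z t + px x t) := by linarith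
        have e5 : 2 / H * (∫ y in (0 : ℝ)..H, φ₁ y ^ 2) =
          -(φ₁ z - φ₁ z ^ 2 + φ z * φ₂ z) := by linarith
        rw [e5, e4]
        field_simp
        ring)
      (by
        intro t ht z hz
        refine abs_source_le (v := φ₁ z / (1 - t)) hH.le
          (intervalIntegral.integral_nonneg hH.le fun _ _ => abs_nonneg _) rfl
          (hmvt z hz t ht).1 (hK₁ z hz t ht) (hK₂ z hz t ht) hε.le ?_ ?_
        · have e1 := hosc x ⟨hx0.le, le_rfl⟩ z hz t ht
          have e2 := (hmvt z hz t ht).2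
          have e := abs_sub_le (ux x z t) (ux 0 z t) (u x z t / x)
          rw [abs_sub_comm (ux 0 z t)] at e
          linarith
        · have := (hwdiff x t ht z hz).trans (hcompare x ⟨hx0.le, le_rfl⟩ t ht)
          linarith)
      (by
        intro t ht z hz
        have := hK x hx01 z hz t ht
        have : 0 ≤ K * (1 + 2 * H) := by positivity
        linarith)
      (by
        intro t ht
        have e1 := hsol.integral_u_eq_zero hH hux (fun y z hz s hs => (hall y z hz s hs).1)
          (fun y z hz s hs => (hall y z hz s hs).2.2.2.1) x (hTJ ht)
        have e2 : ∫ z in (0 : ℝ)..H, φ₁ z = φ H - φ 0 :=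
          intervalIntegral.integral_eq_sub_of_hasDerivAt_of_le hH.le
            (fun z hz => (hφ_z z hz).continuousWithinAt)
            (fun z hz => (hφ_z z (Ioo_subset_Icc_self hz)).hasDerivAt (Icc_mem_nhds hz.1 hz.2))
            (hφ₁c.intervalIntegrable_of_Icc hH.le)
        simp only [hd]
        rw [intervalIntegral.integral_add, intervalIntegral.integral_div,
          intervalIntegral.integral_div, e1, e2, hφ.left_eq_zero, hφ.right_eq_zero]
        · simp
        · exact ((h2 u hsol.contDiffOn_u.continuousOn x t ht).div_const _).intervalIntegrable_of_Icc
            hH.le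
        · exact (hφ₁c.div_const _).intervalIntegrable_of_Icc hH.le)
      T ⟨hT0, le_rfl⟩
    have h0mem : (0 : ℝ) ∈ Icc 0 T := ⟨le_rfl, hT0⟩
    have hTmem : T ∈ Icc 0 T := ⟨hT0, le_rfl⟩
    have hinit : (∫ z in (0 : ℝ)..H, d z 0 ^ 2) ≤ H * ε ^ 2 := by
      have : ∫ z in (0 : ℝ)..H, ε ^ 2 = H * ε ^ 2 := by simp
      rw [← this]
      refine intervalIntegral.integral_mono_on hH.le
        (((hdsec 0 h0mem).pow 2).intervalIntegrable_of_Icc hH.le) intervalIntegrable_const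
        fun z hz => ?_
      have e := (hmvt z hz 0 h0mem).2
      rw [hux0 z hz, sub_neg_eq_add] at e
      rw [← sq_abs]
      simp only [hd, sub_zero, div_one]
      gcongr
    have hI := sq_integral_abs_le hH (hdsec T hTmem)
    set X := Real.exp (K * (2 + 2 * H) * (4 + 2 * H) * T)
    have hIε : (∫ z in (0 : ℝ)..H, |d z T|) ^ 2 ≤ H * ((H + 1) * X) * ε ^ 2 := by
      refine hI.trans ?_
      have : ((∫ z in (0 : ℝ)..H, d z 0 ^ 2) + ε ^ 2) * X ≤ (H * ε ^ 2 + ε ^ 2) * X := by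
        gcongr
      calc _ ≤ H * ((H * ε ^ 2 + ε ^ 2) * X) := by gcongr; exact hE.trans this
        _ = _ := by ring
    have hIle := Real.abs_le_sqrt hIε
    rw [Real.sqrt_mul' _ (sq_nonneg ε), Real.sqrt_sq hε.le] at hIle
    have hcmp : (∫ z in (0 : ℝ)..H, |ux 0 z T + φ₁ z / (1 - T)|) ≤
        (∫ z in (0 : ℝ)..H, |d z T|) + H * (2 * ε) := hcompare 0 ⟨le_rfl, hx0.le⟩ T hTmem
    have := le_abs_self (∫ z in (0 : ℝ)..H, |d z T|)
    rw [hR]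
    linarith
  have hle : |w 0 z₀ T - φ z₀ / (1 - T)| ≤ 0 := by
    refine le_of_forall_pos_le_add fun η hη => ?_
    have := (hwdiff 0 T ⟨hT0, le_rfl⟩ z₀ hz₀).trans (hsmall (η / R) (div_pos hη hRpos))
    rwa [mul_div_cancel₀ _ hRpos.ne', ← zero_add η] at this
  exact sub_eq_zero.1 (abs_nonpos_iff.1 hle)

/-! ### Blow-up at `t = 1`. -/

theorem mainTheorem1 (L H : ℝ) (hL : 0 < L) (hH : 0 < H)
    (φ : ℝ → ℝ) (hφ : IsNontrivialProfile H φ) (k : ℕ) (hk : 0 < k)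
    (J : Set ℝ) (hJ : J.OrdConnected) (hJ_nonneg : J ⊆ Ici 0) (hJ_zero : (0 : ℝ) ∈ J)
    (hJ_nontrivial : J.Nontrivial)
    (u w p : ℝ → ℝ → ℝ → ℝ) (hsol : IsHydrostaticSolution L H J u w p)
    (hu_init : ∀ x : ℝ, ∀ z ∈ Icc 0 H,
      u x z 0 = -L / (2 * Real.pi * k) * Real.sin (2 * Real.pi * k / L * x)
        * derivWithin φ (Icc 0 H) z)
    (hw_init : ∀ x : ℝ, ∀ z ∈ Icc 0 H,
      w x z 0 = Real.cos (2 * Real.pi * k / L * x) * φ z) :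
    J ⊆ Ico 0 1 ∧
    (∀ t ∈ J, ∀ z ∈ Icc 0 H, w 0 z t = φ z / (1 - t)) ∧
    (J = Ico 0 1 → ∀ z ∈ Icc 0 H, φ z ≠ 0 →
      Tendsto (fun t => |w 0 z t|) (𝓝[<] 1) atTop) := by
  have hJu : UniqueDiffOn ℝ J := by
    obtain ⟨a, ha, b, hb, hab⟩ := hJ_nontrivial.exists_lt
    refine uniqueDiffOn_convex hJ.convex ⟨(a + b) / 2, ?_⟩
    exact interior_mono (hJ.out ha hb) (by rw [interior_Icc]; constructor <;> linarith)
  have hw : ∀ t ∈ J, t < 1 → ∀ z ∈ Icc 0 H, w 0 z t = φ z / (1 - t) := fun t ht ht1 z hz =>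
    hsol.w_zero_eq hL hH hφ hk hJ hJu hJ_zero hu_init (hJ_nonneg ht) ht1 ht hz
  have hblow : Ico 0 1 ⊆ J → ∀ z ∈ Icc 0 H, φ z ≠ 0 →
      Tendsto (fun t => |w 0 z t|) (𝓝[<] 1) atTop := by
    intro hsub z hz hne
    refine (tendsto_abs_div_one_sub_atTop hne).congr' ?_
    filter_upwards [Ioo_mem_nhdsLT (zero_lt_one' ℝ)] with t ht
    rw [hw t (hsub (Ioo_subset_Ico_self ht)) ht.2 z hz]
  have hJ1 : J ⊆ Ico 0 1 := by
    intro t ht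
    -- Reaching a time `≥ 1` would put `1` in `J`, where continuity gives `|w(0,z,·)|` a finite left
    -- limit although the explicit formula makes it diverge at any `z` with `φ z ≠ 0`.
    refine ⟨hJ_nonneg ht, not_le.1 fun h1 => ?_⟩
    have hsub : Icc 0 1 ⊆ J := (Icc_subset_Icc_right h1).trans (hJ.out hJ_zero ht)
    obtain ⟨z, hz, hne⟩ := hφ.nontrivial
    have hc : ContinuousOn (fun s => w 0 z s) J :=
      hsol.contDiffOn_w.continuousOn.comp (f := fun s : ℝ => ((0 : ℝ), z, s)) (by fun_prop)
        fun s hs => ⟨mem_univ _, hz, hs⟩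
    have hlim : Tendsto (fun s => |w 0 z s|) (𝓝[<] 1) (𝓝 |w 0 z 1|) := by
      refine ((hc 1 (hsub ⟨zero_le_one, le_rfl⟩)).mono_left ?_).abs
      rw [nhdsWithin_le_iff]
      exact mem_of_superset (Ioo_mem_nhdsLT (zero_lt_one' ℝ)) (Ioo_subset_Icc_self.trans hsub)
    exact not_tendsto_nhds_of_tendsto_atTop
      (hblow (Ico_subset_Icc_self.trans hsub) z hz hne) _ hlim
  exact ⟨hJ1, fun t ht => hw t ht (hJ1 ht).2, fun h => hblow h.ge⟩
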